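/- Let $p_d$ ($d\ge 0$) be the orthonormal Legendre polynomial of degree $d$ on $[-1,1]$ (with positive leading coefficient), and let $\Theta(x)=0$ for $x<0$ and $\Theta(x)=1$ for $x\ge 0$. For a function $g(t,s)$ on $[-1,1]^2$, its coefficient matrix is the infinite matrix with entries $$g_{k,\ell}=\int_{-1}^{1}\int_{-1}^{1} g(\tau,\rho)\,p_k(\tau)\,p_\ell(\rho)\,d\rho\,d\tau,\qquad k,\ell\ge 0.$$ An infinite matrix $A=[a_{k,\ell}]_{k,\ell\ge 0}$ is called $N$-banded if $a_{k,\ell}=0$ whenever $|k-\ell|>N$, and $\|A\|_\infty:=\sup_{k\ge 0}\sum_{\ell\ge 0}|a_{k,\ell}|\in[0,\infty]$. Let $\tilde f:[-1,1]\to\mathbb{C}$ be (real-)analytic on $[-1,1]$, endpoints included, let $F$ be the coefficient matrix of $\tilde f(t)\Theta(t-s)$, let $B^{(d)}$ be the coefficient matrix of $p_d(t)\Theta(t-s)$, let $\alpha_d=\int_{-1}^1\tilde f(t)p_d(t)\,dt$, and let $F^{(N)}=\sum_{d=0}^{N}\alpha_d B^{(d)}$. Then for every tolerance $\delta>0$ there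 is $N_0$ such that for all $N\ge N_0$ the matrix $F^{(N)}$ is $(N+1)$-banded and $$\|F-F^{(N)}\|_\infty\le\delta .$$ In particular $F$ is numerically banded: for every $\delta>0$ there is a banded matrix $A$ (i.e. one that is $n$-banded for some $n$) with $\|F-A\|_\infty\le\delta$. -/

import Mathlib

namespace LegendreBand

open Polynomial in
/-- The Legendre polynomial `P_n = 1 / (2^n n!) * dⁿ/dXⁿ (X² - 1)ⁿ` (Rodrigues' formula). -/
noncomputable def legendre (n : ℕ) : ℝ[X] :=
  C ((2 ^ n * (n.factorial : ℝ))⁻¹) * derivative^[n] ((X ^ 2 - 1) ^ n)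

/-- The orthonormal Legendre polynomial of degree `n` on `[-1, 1]`, as a function on `ℝ`:
`p_n = √((2n+1)/2) * P_n`. -/
noncomputable def orthoLegendre (n : ℕ) (t : ℝ) : ℝ :=
  Real.sqrt ((2 * (n : ℝ) + 1) / 2) * (legendre n).eval t

/-- The Heaviside step function: `0` for negative arguments, `1` otherwise. -/
noncomputable def heaviside (x : ℝ) : ℝ := if x < 0 then 0 else 1

/-- The coefficient matrix of a function `g(t,s)` on `[-1,1]²`, the infinite matrix of its Fourier
coefficients `∫_{-1}^1 ∫_{-1}^1 g(τ,ρ) p_k(τ) p_ℓ(ρ) dρ dτ`. -/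
noncomputable def coeffMatrix (g : ℝ → ℝ → ℂ) : Matrix ℕ ℕ ℂ :=
  Matrix.of fun k l => ∫ τ in (-1 : ℝ)..1, ∫ ρ in (-1 : ℝ)..1,
    g τ ρ * (orthoLegendre k τ : ℂ) * (orthoLegendre l ρ : ℂ)

/-- The Legendre coefficient `α_d = ∫_{-1}^1 f(t) p_d(t) dt`. -/
noncomputable def legendreCoeff (f : ℝ → ℂ) (d : ℕ) : ℂ :=
  ∫ t in (-1 : ℝ)..1, f t * (orthoLegendre d t : ℂ)

/-- The matrix `F`: coefficient matrix of `f(t) Θ(t - s)`. -/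
noncomputable def heavisideMatrix (f : ℝ → ℂ) : Matrix ℕ ℕ ℂ :=
  coeffMatrix fun t s => f t * (heaviside (t - s) : ℂ)

/-- The Legendre basis matrix `B^{(d)}`: coefficient matrix of `p_d(t) Θ(t - s)`. -/
noncomputable def basisMatrix (d : ℕ) : Matrix ℕ ℕ ℂ :=
  heavisideMatrix fun t => (orthoLegendre d t : ℂ)

/-- The truncation `F^{(N)} = ∑_{d=0}^N α_d B^{(d)}`. -/
noncomputable def truncMatrix (f : ℝ → ℂ) (N : ℕ) : Matrix ℕ ℕ ℂ :=
  ∑ d ∈ Finset.range (N + 1), legendreCoeff f d • basisMatrix d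

/-- `A` is `N`-banded: `a_{k,ℓ} = 0` whenever `|k - ℓ| > N`. -/
def IsBanded (N : ℕ) (A : Matrix ℕ ℕ ℂ) : Prop :=
  ∀ k l : ℕ, (N : ℤ) < |(k : ℤ) - (l : ℤ)| → A k l = 0

/-- The infinity norm `sup_k ∑_ℓ |a_{k,ℓ}|` of an infinite matrix, with values in `[0, ∞]`. -/
noncomputable def infNorm (A : Matrix ℕ ℕ ℂ) : ENNReal :=
  ⨆ k : ℕ, ∑' l : ℕ, ‖A k l‖ₑ

/-- `A` is numerically banded: it is approximated by banded matrices up to any tolerance. -/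
def IsNumericallyBanded (A : Matrix ℕ ℕ ℂ) : Prop :=
  ∀ δ : ℝ, 0 < δ → ∃ (N : ℕ) (A' : Matrix ℕ ℕ ℂ),
    IsBanded N A' ∧ infNorm (A - A') ≤ ENNReal.ofReal δ

end LegendreBand

/-! The heart of the matter is that r ↦ (coefficient matrix of r(t)Θ(t-s)) is bounded from the sup
norm to `infNorm`, with constant 4 (`infNorm_heavisideMatrix_le`). The inner integral replaces p_l
by its primitive, so the (k,l) entry is ∫ r p_k (primitive of p_l). For l ≥ 1 the Legendre equation
gives this primitive as -(1-x²)p_l'/(l(l+1)), and the functions √(1-x²) p_l'/√(l(l+1)) are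
orthonormal. Bessel bounds the ℓ² norm of the rescaled row by ‖r p_k‖₂ ≤ sup|r|; Cauchy–Schwarz with
∑ 1/(l(l+1)) = 1 then bounds the row sum over l ≥ 1, uniformly in k.

By linearity F - F^{(N)} is the matrix of the Legendre remainder of f, so it suffices that the
Legendre series converges uniformly (`eventually_norm_sub_legendre_sum_le`). Only C² regularity
enters: α_n = O(n⁻²), while |p_n| ≤ √(n+1/2).

Bandedness of B^{(d)} is orthogonality to polynomials of low degree (`isBanded_basisMatrix`). -/

namespace LegendreBand

open Polynomial MeasureTheory

/-! ### Rodrigues' formula: orthogonality and endpoint values. -/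

/-- The integral of a polynomial over `[-1, 1]`. -/
noncomputable def polyIntegral : ℝ[X] →ₗ[ℝ] ℝ where
  toFun p := ∫ x in (-1 : ℝ)..1, p.eval x
  map_add' p q := by
    simp only [eval_add]
    exact intervalIntegral.integral_add (p.continuous.intervalIntegrable _ _)
      (q.continuous.intervalIntegrable _ _)
  map_smul' c p := by simp

theorem polyIntegral_apply (p : ℝ[X]) : polyIntegral p = ∫ x in (-1 : ℝ)..1, p.eval x := rfl

theorem polyIntegral_C_mul (c : ℝ) (p : ℝ[X]) : polyIntegral (C c * p) = c * polyIntegral p := by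
  rw [← smul_eq_C_mul, map_smul, smul_eq_mul]

theorem polyIntegral_derivative (p : ℝ[X]) :
    polyIntegral (derivative p) = p.eval 1 - p.eval (-1) :=
  intervalIntegral.integral_eq_sub_of_hasDerivAt (fun x _ => p.hasDerivAt x)
    ((derivative p).continuous.intervalIntegrable _ _)

theorem polyIntegral_derivative_mul (p q : ℝ[X]) :
    polyIntegral (derivative p * q) =
      p.eval 1 * q.eval 1 - p.eval (-1) * q.eval (-1) - polyIntegral (p * derivative q) := by
  have h := polyIntegral_derivative (p * q)
  rw [derivative_mul, map_add, eval_mul, eval_mul] at h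
  linarith

/-- Both ±1 are zeros of order n of (X²-1)^n; this kills all boundary terms in the repeated
integration by parts. -/
theorem eval_iterate_derivative_eq_zero_of_lt (n j : ℕ) (hj : j < n) (x : ℝ) (hx : x ^ 2 = 1) :
    (derivative^[j] ((X ^ 2 - 1 : ℝ[X]) ^ n)).eval x = 0 := by
  obtain ⟨r, hr⟩ := pow_sub_dvd_iterate_derivative_pow (X ^ 2 - 1 : ℝ[X]) n j
  rw [hr]
  simp [hx, Nat.sub_ne_zero_of_lt hj]

theorem polyIntegral_iterate_derivative_mul (n j : ℕ) (hj : j ≤ n) (q : ℝ[X]) :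
    polyIntegral (derivative^[j] ((X ^ 2 - 1) ^ n) * q) =
      (-1) ^ j * polyIntegral ((X ^ 2 - 1) ^ n * derivative^[j] q) := by
  induction j generalizing q with
  | zero => simp
  | succ j ih =>
    rw [Function.iterate_succ_apply', polyIntegral_derivative_mul, ih (by omega),
      eval_iterate_derivative_eq_zero_of_lt n j hj 1 (by norm_num),
      eval_iterate_derivative_eq_zero_of_lt n j hj (-1) (by norm_num),
      Function.iterate_succ_apply]
    ring

theorem polyIntegral_legendre_mul_eq_zero (n : ℕ) (q : ℝ[X]) (hq : q.degree < n) :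
    polyIntegral (legendre n * q) = 0 := by
  rw [legendre, mul_assoc, polyIntegral_C_mul, polyIntegral_iterate_derivative_mul n n le_rfl,
    iterate_derivative_eq_zero_of_degree_lt hq]
  simp

theorem natDegree_legendre_le (n : ℕ) : (legendre n).natDegree ≤ n := by
  refine (natDegree_C_mul_le _ _).trans ((natDegree_iterate_derivative _ _).trans ?_)
  have : ((X ^ 2 - 1 : ℝ[X]) ^ n).natDegree ≤ n * 2 :=
    natDegree_pow_le_of_le n (by compute_degree)
  omega

theorem legendre_zero : legendre 0 = 1 := by simp [legendre]

/-- Only the Leibniz term in which every derivative falls on (X-a)^n survives at a. It gives P_n(±1)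
after factoring X²-1. -/
theorem eval_iterate_derivative_X_sub_C_pow_mul (n : ℕ) (a : ℝ) (g : ℝ[X]) :
    (derivative^[n] ((X - C a) ^ n * g)).eval a = n.factorial * g.eval a := by
  induction n generalizing g with
  | zero => simp
  | succ n ih =>
    have : derivative ((X - C a) ^ (n + 1) * g) =
        (X - C a) ^ n * (C (n + 1 : ℝ) * g + (X - C a) * derivative g) := by
      simp [derivative_pow]
      ring
    rw [Function.iterate_succ_apply, this, ih, Nat.factorial_succ]
    simp
    ring

theorem eval_one_legendre (n : ℕ) : (legendre n).eval 1 = 1 := by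
  have : (X ^ 2 - 1 : ℝ[X]) ^ n = (X - C 1) ^ n * (X + 1) ^ n := by
    rw [← mul_pow, C_1]; ring
  rw [legendre, eval_mul, this, eval_iterate_derivative_X_sub_C_pow_mul, eval_C]
  have := n.factorial_ne_zero
  simp
  norm_num
  field_simp

theorem eval_neg_one_legendre (n : ℕ) : (legendre n).eval (-1) = (-1) ^ n := by
  have : (X ^ 2 - 1 : ℝ[X]) ^ n = (X - C (-1)) ^ n * (X - 1) ^ n := by
    rw [← mul_pow, C_neg, C_1]; ring
  rw [legendre, eval_mul, this, eval_iterate_derivative_X_sub_C_pow_mul, eval_C]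
  have := n.factorial_ne_zero
  have h2 : (-1 - 1 : ℝ) = 2 * (-1) := by norm_num
  simp
  rw [h2, mul_pow]
  field_simp

/-! ### The Legendre equation, the L² norm and the pointwise bound. -/

theorem legendre_differential_equation (n : ℕ) :
    derivative ((1 - X ^ 2) * derivative (legendre n)) =
      -C ((n : ℝ) * (n + 1)) * legendre n := by
  set u : ℝ[X] := (X ^ 2 - 1) ^ n with hu
  -- The first-order equation (X²-1)u' = 2nXu, differentiated n+1 times, is Legendre's equation for
  -- the n-th derivative of u.
  have h0 : derivative u * X * X - derivative u = C (2 * n : ℝ) * (u * X) := by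
    rcases n with _ | n
    · simp [hu]
    · simp [hu, derivative_pow]
      ring
  have h1 := congrArg (derivative^[n + 1]) h0
  rw [iterate_derivative_sub, iterate_derivative_C_mul, iterate_derivative_mul_X,
    iterate_derivative_derivative_mul_X, Nat.add_sub_cancel, iterate_derivative_derivative_mul_X,
    iterate_derivative_mul_X, Nat.add_sub_cancel, ← Function.iterate_succ_apply,
    Function.iterate_succ_apply' _ (n + 1), Function.iterate_succ_apply' _ n] at h1
  rw [legendre, ← hu]
  generalize derivative^[n] u = y at h1 ⊢
  generalize (2 ^ n * (n.factorial : ℝ))⁻¹ = c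
  have h2 : (C 2 : ℝ[X]) = 2 := map_ofNat C 2
  simp [derivative_mul, h2] at h1 ⊢
  linear_combination -C c * h1

/-- Integrating (xP)'P by parts gives ∫P² + 2∫xPP' = 2. Since xP' - nP has degree below n, ∫xPP' =
n∫P². -/
theorem polyIntegral_legendre_sq (n : ℕ) :
    polyIntegral (legendre n * legendre n) = 2 / (2 * n + 1) := by
  have h1 := polyIntegral_derivative_mul (X * legendre n) (legendre n)
  have hd : (X * derivative (legendre n) - C (n : ℝ) * legendre n).degree < (n : WithBot ℕ) := by
    rw [degree_lt_iff_coeff_zero]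
    intro m hm
    rcases hm.eq_or_lt with rfl | hm
    · rw [coeff_sub, coeff_C_mul]
      rcases n with _ | n
      · simp [legendre_zero]
      · rw [coeff_X_mul, coeff_derivative]
        push_cast
        ring
    · have hc : (legendre n).coeff m = 0 :=
        coeff_eq_zero_of_natDegree_lt ((natDegree_legendre_le n).trans_lt hm)
      obtain ⟨m, rfl⟩ : ∃ k, m = k + 1 := ⟨m - 1, by omega⟩
      simp [coeff_X_mul, coeff_derivative, hc]
  have h2 := polyIntegral_legendre_mul_eq_zero n _ hd
  rw [mul_sub, map_sub, ← mul_assoc, mul_left_comm (legendre n) (C _), polyIntegral_C_mul] at h2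
  rw [derivative_mul, derivative_X, one_mul, add_mul, map_add] at h1
  simp only [eval_mul, eval_X, eval_one_legendre, eval_neg_one_legendre] at h1
  have h3 : ((-1 : ℝ) ^ n) * (-1) ^ n = 1 := by rw [← mul_pow]; norm_num
  have e1 : X * derivative (legendre n) * legendre n = legendre n * X * derivative (legendre n) := by
    ring
  have e2 : X * legendre n * derivative (legendre n) = legendre n * X * derivative (legendre n) := by
    ring
  rw [e1, e2] at h1
  rw [eq_div_iff (by positivity)]
  linear_combination h1 - 2 * h2 + h3

theorem eval_legendre_differential_equation (n : ℕ) (x : ℝ) :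
    (1 - x ^ 2) * (derivative (derivative (legendre n))).eval x =
      2 * x * (derivative (legendre n)).eval x - n * (n + 1) * (legendre n).eval x := by
  have h := congrArg (eval x) (legendre_differential_equation n)
  simp [derivative_mul] at h
  linarith

theorem abs_eval_legendre_le_one (n : ℕ) {x : ℝ} (hx : x ∈ Set.Icc (-1 : ℝ) 1) :
    |(legendre n).eval x| ≤ 1 := by
  rcases Nat.eq_zero_or_pos n with rfl | hn
  · simp [legendre_zero]
  set c : ℝ := n * (n + 1) with hc
  have hcpos : 0 < c := by positivity
  -- By the differential equation this auxiliary function has derivative 2xP'², so on [-1,1] it is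
  -- largest at the endpoints, where it equals n(n+1); it dominates n(n+1)P².
  set p : ℝ[X] := C c * legendre n ^ 2 + (1 - X ^ 2) * derivative (legendre n) ^ 2 with hp
  have hp' (y : ℝ) : deriv (fun x => p.eval x) y = 2 * y * (derivative (legendre n)).eval y ^ 2 := by
    rw [Polynomial.deriv]
    have := eval_legendre_differential_equation n y
    simp [hp, derivative_pow]
    linear_combination (2 * (derivative (legendre n)).eval y) * this
  have h1 : p.eval 1 = c := by simp [hp, eval_one_legendre]
  have h2 : p.eval (-1) = c := by
    simp [hp, eval_neg_one_legendre, ← pow_mul, mul_comm n 2]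
  have hle : p.eval x ≤ c := by
    rcases le_total 0 x with h0 | h0
    · rw [← h1]
      refine monotoneOn_of_deriv_nonneg (convex_Icc 0 1) p.continuous.continuousOn
        p.differentiable.differentiableOn (fun y hy => ?_) ⟨h0, hx.2⟩ ⟨zero_le_one, le_rfl⟩ hx.2
      rw [interior_Icc] at hy
      rw [hp']
      have := hy.1
      positivity
    · rw [← h2]
      refine antitoneOn_of_deriv_nonpos (convex_Icc (-1) 0) p.continuous.continuousOn
        p.differentiable.differentiableOn (fun y hy => ?_) ⟨le_rfl, by norm_num⟩ ⟨hx.1, h0⟩ hx.1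
      rw [interior_Icc] at hy
      rw [hp']
      exact mul_nonpos_of_nonpos_of_nonneg (by linarith [hy.2]) (sq_nonneg _)
  have hx2 : 0 ≤ 1 - x ^ 2 := by nlinarith [hx.1, hx.2]
  have : c * (legendre n).eval x ^ 2 ≤ c * 1 := by
    simp [hp] at hle
    nlinarith [mul_nonneg hx2 (sq_nonneg ((derivative (legendre n)).eval x))]
  rw [← sq_le_one_iff_abs_le_one]
  exact le_of_mul_le_mul_left this hcpos

/-! ### Orthonormal polynomials, their derivatives and primitives. -/

/-- The orthonormal Legendre polynomial of degree `n`, as a polynomial. -/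
noncomputable def orthoPoly (n : ℕ) : ℝ[X] :=
  C (Real.sqrt ((2 * (n : ℝ) + 1) / 2)) * legendre n

theorem eval_orthoPoly (n : ℕ) (t : ℝ) : (orthoPoly n).eval t = orthoLegendre n t := by
  simp [orthoPoly, orthoLegendre]

theorem continuous_orthoLegendre (n : ℕ) : Continuous (orthoLegendre n) := by
  simp_rw [← funext (eval_orthoPoly n)]
  exact (orthoPoly n).continuous

theorem degree_orthoPoly_le (n : ℕ) : (orthoPoly n).degree ≤ n :=
  natDegree_le_iff_degree_le.mp ((natDegree_C_mul_le _ _).trans (natDegree_legendre_le n))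

theorem polyIntegral_orthoPoly_mul_eq_zero (n : ℕ) (q : ℝ[X]) (hq : q.degree < n) :
    polyIntegral (orthoPoly n * q) = 0 := by
  rw [orthoPoly, mul_assoc, polyIntegral_C_mul, polyIntegral_legendre_mul_eq_zero n q hq, mul_zero]

theorem polyIntegral_orthoPoly_sq (n : ℕ) : polyIntegral (orthoPoly n * orthoPoly n) = 1 := by
  rw [orthoPoly, mul_assoc, mul_left_comm (legendre n), polyIntegral_C_mul, polyIntegral_C_mul,
    polyIntegral_legendre_sq, ← mul_assoc, Real.mul_self_sqrt (by positivity)]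
  field_simp

theorem polyIntegral_orthoPoly_mul_orthoPoly (m n : ℕ) :
    polyIntegral (orthoPoly m * orthoPoly n) = if m = n then 1 else 0 := by
  split_ifs with h
  · rw [h, polyIntegral_orthoPoly_sq]
  · rcases lt_or_gt_of_ne h with h | h
    · rw [mul_comm]
      exact polyIntegral_orthoPoly_mul_eq_zero n _
        ((degree_orthoPoly_le m).trans_lt (by exact_mod_cast h))
    · exact polyIntegral_orthoPoly_mul_eq_zero m _
        ((degree_orthoPoly_le n).trans_lt (by exact_mod_cast h))

theorem coeff_orthoPoly_ne_zero (n : ℕ) : (orthoPoly n).coeff n ≠ 0 := by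
  intro h
  have hd : (orthoPoly n).degree < n := by
    refine lt_of_le_of_ne (degree_orthoPoly_le n) fun hd => ?_
    exact coeff_ne_zero_of_eq_degree hd h
  have := polyIntegral_orthoPoly_mul_eq_zero n _ hd
  rw [polyIntegral_orthoPoly_sq] at this
  exact one_ne_zero this

theorem orthoPoly_differential_equation (n : ℕ) :
    derivative ((1 - X ^ 2) * derivative (orthoPoly n)) =
      -C ((n : ℝ) * (n + 1)) * orthoPoly n := by
  rw [orthoPoly, derivative_C_mul, mul_left_comm, derivative_C_mul,
    legendre_differential_equation]
  ring

/-- Orthogonality of the derivatives of the Legendre polynomials for the weight `1 - x²`. -/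
theorem polyIntegral_weight_mul_derivative_mul_derivative (m n : ℕ) :
    polyIntegral ((1 - X ^ 2) * derivative (orthoPoly m) * derivative (orthoPoly n)) =
      if m = n then (n : ℝ) * (n + 1) else 0 := by
  have h := polyIntegral_derivative_mul (orthoPoly n) ((1 - X ^ 2) * derivative (orthoPoly m))
  rw [orthoPoly_differential_equation, ← C_neg, mul_left_comm (orthoPoly n),
    polyIntegral_C_mul, polyIntegral_orthoPoly_mul_orthoPoly] at h
  rw [mul_comm, h]
  rcases eq_or_ne m n with rfl | hmn
  · simp
  · simp [hmn, hmn.symm]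

/-- Integration by parts moves the derivative onto q(1-x²), whose derivative has degree at most deg
q + 1. Using the primitive's own formula here gives the upper edge of the band. -/
theorem polyIntegral_mul_weight_mul_derivative_eq_zero (n : ℕ) (q : ℝ[X])
    (hq : q.natDegree + 1 < n) :
    polyIntegral (q * ((1 - X ^ 2) * derivative (orthoPoly n))) = 0 := by
  have h := polyIntegral_derivative_mul (orthoPoly n) (q * (1 - X ^ 2))
  rw [polyIntegral_orthoPoly_mul_eq_zero] at h
  · rw [← mul_assoc, mul_comm, h]
    simp
  · refine degree_le_natDegree.trans_lt ?_
    have h1 := natDegree_derivative_le (q * (1 - X ^ 2))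
    have h2 : (q * (1 - X ^ 2)).natDegree ≤ q.natDegree + 2 :=
      natDegree_mul_le.trans (Nat.add_le_add_left (by compute_degree) _)
    exact_mod_cast (by omega : _ < n)

/-- The primitive of the orthonormal Legendre polynomial of degree `n` that vanishes at `-1`. -/
noncomputable def orthoPrimitive (n : ℕ) : ℝ[X] :=
  if n = 0 then C (Real.sqrt (1 / 2)) * (X + 1)
  else C (-((n : ℝ) * (n + 1))⁻¹) * ((1 - X ^ 2) * derivative (orthoPoly n))

/-- For n ≥ 1 this is the Legendre equation divided by -n(n+1); n = 0 needs its own formula because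
that factor vanishes. -/
theorem derivative_orthoPrimitive (n : ℕ) : derivative (orthoPrimitive n) = orthoPoly n := by
  rw [orthoPrimitive]
  split_ifs with h
  · subst h
    simp [orthoPoly, legendre_zero]
  · have : (n : ℝ) * (n + 1) ≠ 0 := by positivity
    rw [derivative_C_mul, orthoPoly_differential_equation, ← C_neg, ← mul_assoc, ← C_mul,
      neg_mul_neg, inv_mul_cancel₀ this, C_1, one_mul]

theorem eval_neg_one_orthoPrimitive (n : ℕ) : (orthoPrimitive n).eval (-1) = 0 := by
  rw [orthoPrimitive]
  split_ifs <;> simp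

theorem natDegree_orthoPrimitive_le (n : ℕ) : (orthoPrimitive n).natDegree ≤ n + 1 := by
  rw [orthoPrimitive]
  split_ifs with h
  · subst h
    compute_degree
  · refine (natDegree_C_mul_le _ _).trans (natDegree_mul_le.trans ?_)
    have h1 := natDegree_derivative_le (orthoPoly n)
    have h2 : (1 - X ^ 2 : ℝ[X]).natDegree ≤ 2 := by compute_degree
    have h3 : (orthoPoly n).natDegree ≤ n := natDegree_le_iff_degree_le.mpr (degree_orthoPoly_le n)
    omega

theorem integral_orthoLegendre (n : ℕ) (t : ℝ) :
    ∫ x in (-1 : ℝ)..t, orthoLegendre n x = (orthoPrimitive n).eval t := by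
  have h := intervalIntegral.integral_eq_sub_of_hasDerivAt (a := -1) (b := t)
    (fun x _ => (orthoPrimitive n).hasDerivAt x)
    ((derivative (orthoPrimitive n)).continuous.intervalIntegrable _ _)
  simpa only [derivative_orthoPrimitive, eval_orthoPoly, eval_neg_one_orthoPrimitive, sub_zero]
    using h

/-! ### Matrix entries as single integrals, and bandedness. -/

theorem integral_heaviside_mul (g : ℝ → ℂ) (hg : Continuous g) {t : ℝ}
    (ht : t ∈ Set.Icc (-1 : ℝ) 1) :
    ∫ x in (-1 : ℝ)..1, (heaviside (t - x) : ℂ) * g x = ∫ x in (-1 : ℝ)..t, g x := by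
  have h1 : Set.EqOn (fun x => (heaviside (t - x) : ℂ) * g x) g (Set.uIoc (-1) t) := by
    intro x hx
    rw [Set.uIoc_of_le ht.1] at hx
    simp [heaviside, not_lt.mpr hx.2]
  have h2 : Set.EqOn (fun x => (heaviside (t - x) : ℂ) * g x) 0 (Set.uIoc t 1) := by
    intro x hx
    rw [Set.uIoc_of_le ht.2] at hx
    simp [heaviside, hx.1]
  rw [← intervalIntegral.integral_add_adjacent_intervals (b := t),
    intervalIntegral.integral_congr_ae (Filter.Eventually.of_forall h1),
    intervalIntegral.integral_congr_ae (Filter.Eventually.of_forall h2)]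
  · simp
  · exact (hg.intervalIntegrable _ _).congr h1.symm
  · exact (intervalIntegrable_const (c := (0 : ℂ))).congr h2.symm

theorem heavisideMatrix_apply (f : ℝ → ℂ) (k l : ℕ) :
    heavisideMatrix f k l =
      ∫ t in (-1 : ℝ)..1, f t * (orthoLegendre k t : ℂ) * (((orthoPrimitive l).eval t : ℝ) : ℂ) := by
  rw [heavisideMatrix, coeffMatrix, Matrix.of_apply]
  refine intervalIntegral.integral_congr fun t ht => ?_
  rw [Set.uIcc_of_le (by norm_num)] at ht
  have h (x : ℝ) : f t * (heaviside (t - x) : ℂ) * (orthoLegendre k t : ℂ) * (orthoLegendre l x : ℂ)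
      = f t * (orthoLegendre k t : ℂ) * ((heaviside (t - x) : ℂ) * (orthoLegendre l x : ℂ)) := by
    ring
  simp only [h]
  rw [intervalIntegral.integral_const_mul, integral_heaviside_mul
    (fun x => (orthoLegendre l x : ℂ))
    (Complex.continuous_ofReal.comp (continuous_orthoLegendre l)) ht,
    intervalIntegral.integral_ofReal, integral_orthoLegendre]

theorem basisMatrix_apply (d k l : ℕ) :
    basisMatrix d k l =
      (polyIntegral (orthoPoly d * orthoPoly k * orthoPrimitive l) : ℂ) := by
  rw [basisMatrix, heavisideMatrix_apply, polyIntegral_apply, ← intervalIntegral.integral_ofReal]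
  simp [eval_orthoPoly]

theorem isBanded_basisMatrix (d : ℕ) : IsBanded (d + 1) (basisMatrix d) := by
  intro k l h
  rw [basisMatrix_apply, Complex.ofReal_eq_zero]
  have hdeg (n : ℕ) : (orthoPoly n).natDegree ≤ n :=
    natDegree_le_iff_degree_le.mpr (degree_orthoPoly_le n)
  have hd := hdeg d
  have hk := hdeg k
  have hl := natDegree_orthoPrimitive_le l
  rcases lt_abs.mp h with h | h
  -- Case k > l + d + 1: p_k is orthogonal to p_d times the primitive, of degree at most d + l + 1.
  · rw [mul_comm (orthoPoly d), mul_assoc]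
    refine polyIntegral_orthoPoly_mul_eq_zero k _ (degree_le_natDegree.trans_lt ?_)
    have := natDegree_mul_le (p := orthoPoly d) (q := orthoPrimitive l)
    exact_mod_cast (by omega : _ < k)
  -- Case l > k + d + 1: p_d p_k has degree at most d + k, and the orthogonality now comes from the
  -- primitive of p_l.
  · have hl0 : l ≠ 0 := by omega
    rw [orthoPrimitive, if_neg hl0, mul_left_comm, polyIntegral_C_mul,
      polyIntegral_mul_weight_mul_derivative_eq_zero, mul_zero]
    have := natDegree_mul_le (p := orthoPoly d) (q := orthoPoly k)
    omega

theorem isBanded_truncMatrix (f : ℝ → ℂ) (N : ℕ) : IsBanded (N + 1) (truncMatrix f N) := by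
  intro k l h
  rw [truncMatrix, Matrix.sum_apply]
  refine Finset.sum_eq_zero fun d hd => ?_
  rw [Matrix.smul_apply, isBanded_basisMatrix d k l, smul_zero]
  have := Finset.mem_range.mp hd
  omega

/-! ### Decay of the Legendre coefficients. -/

theorem abs_orthoLegendre_le (n : ℕ) {x : ℝ} (hx : x ∈ Set.Icc (-1 : ℝ) 1) :
    |orthoLegendre n x| ≤ Real.sqrt ((2 * (n : ℝ) + 1) / 2) := by
  rw [orthoLegendre, abs_mul, abs_of_nonneg (Real.sqrt_nonneg _)]
  exact mul_le_of_le_one_right (Real.sqrt_nonneg _) (abs_eval_legendre_le_one n hx)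

theorem integral_orthoLegendre_sq (n : ℕ) :
    ∫ x in (-1 : ℝ)..1, orthoLegendre n x ^ 2 = 1 := by
  have h := polyIntegral_orthoPoly_sq n
  simp only [polyIntegral_apply, eval_mul, eval_orthoPoly] at h
  simpa only [sq] using h

/-- The `L¹`-`L^∞` bound for Legendre coefficients. -/
theorem norm_legendreCoeff_le (g : ℝ → ℂ) (M : ℝ)
    (hM : ∀ x ∈ Set.Icc (-1 : ℝ) 1, ‖g x‖ ≤ M) (n : ℕ) : ‖legendreCoeff g n‖ ≤ M * (3 / 2) := by
  have hc := continuous_orthoLegendre n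
  have hM0 : 0 ≤ M := (norm_nonneg _).trans (hM 0 (by norm_num))
  -- From |p| ≤ (1+p²)/2 and ∫p² = 1 one gets ∫|p| ≤ 3/2.
  have h : ‖legendreCoeff g n‖ ≤ ∫ x in (-1 : ℝ)..1, M * ((1 + orthoLegendre n x ^ 2) / 2) := by
    refine intervalIntegral.norm_integral_le_of_norm_le (by norm_num)
      (Filter.Eventually.of_forall fun x hx => ?_)
      (Continuous.intervalIntegrable (by fun_prop) _ _)
    rw [norm_mul, Complex.norm_real, Real.norm_eq_abs]
    refine mul_le_mul (hM x (Set.Ioc_subset_Icc_self hx)) ?_ (abs_nonneg _) hM0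
    nlinarith [sq_nonneg (|orthoLegendre n x| - 1), sq_abs (orthoLegendre n x)]
  refine h.trans_eq ?_
  rw [intervalIntegral.integral_const_mul, intervalIntegral.integral_div,
    intervalIntegral.integral_add intervalIntegrable_const
      (Continuous.intervalIntegrable (by fun_prop) _ _), integral_orthoLegendre_sq]
  norm_num

theorem hasDerivWithinAt_eval_ofReal (p : ℝ[X]) (s : Set ℝ) (x : ℝ) :
    HasDerivWithinAt (fun y => ((p.eval y : ℝ) : ℂ)) (((derivative p).eval x : ℝ) : ℂ) s x :=
  (p.hasDerivAt x).ofReal_comp.hasDerivWithinAt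

theorem continuous_eval_ofReal (p : ℝ[X]) : Continuous fun y : ℝ => ((p.eval y : ℝ) : ℂ) :=
  Complex.continuous_ofReal.comp p.continuous

/-- Twice integrating by parts against the Legendre differential operator. -/
theorem mul_legendreCoeff_eq (f f₁ f₂ : ℝ → ℂ)
    (h₁ : ∀ x ∈ Set.Icc (-1 : ℝ) 1, HasDerivWithinAt f (f₁ x) (Set.Icc (-1) 1) x)
    (h₂ : ∀ x ∈ Set.Icc (-1 : ℝ) 1, HasDerivWithinAt f₁ (f₂ x) (Set.Icc (-1) 1) x)
    (hc : ContinuousOn f₂ (Set.Icc (-1) 1)) (n : ℕ) :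
    ((n : ℂ) * (n + 1)) * legendreCoeff f n =
      -legendreCoeff (fun x => f₂ x * (1 - (x : ℂ) ^ 2) - 2 * x * f₁ x) n := by
  have hI : Set.uIcc (-1 : ℝ) 1 = Set.Icc (-1) 1 := Set.uIcc_of_le (by norm_num)
  have hc₁ : ContinuousOn f₁ (Set.Icc (-1) 1) := fun x hx => (h₂ x hx).continuousWithinAt
  have hw (x : ℝ) : HasDerivWithinAt (fun y : ℝ => (1 - (y : ℂ) ^ 2)) (-(2 * (x : ℂ)))
      (Set.Icc (-1) 1) x := by
    have h := hasDerivWithinAt_eval_ofReal (1 - X ^ 2) (Set.Icc (-1) 1) x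
    simp only [eval_sub, eval_one, eval_pow, eval_X, derivative_sub, derivative_one,
      derivative_X_pow] at h
    simpa using h
  have hcont : ContinuousOn (fun x : ℝ => f₂ x * (1 - (x : ℂ) ^ 2) + f₁ x * -(2 * (x : ℂ)))
      (Set.Icc (-1) 1) := by fun_prop
  -- In both integrations by parts the factor 1-x² removes the boundary terms, so f needs no
  -- endpoint conditions.
  have e1 := intervalIntegral.integral_mul_deriv_eq_deriv_mul_of_hasDerivWithinAt
    (a := -1) (b := 1) (u := f) (u' := f₁) (hI ▸ h₁)
    (fun x _ => hasDerivWithinAt_eval_ofReal ((1 - X ^ 2) * derivative (orthoPoly n)) _ x)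
    (hI ▸ hc₁).intervalIntegrable ((continuous_eval_ofReal _).intervalIntegrable _ _)
  have e2 := intervalIntegral.integral_mul_deriv_eq_deriv_mul_of_hasDerivWithinAt
    (a := -1) (b := 1) (u := fun x : ℝ => f₁ x * (1 - (x : ℂ) ^ 2))
    (u' := fun x : ℝ => f₂ x * (1 - (x : ℂ) ^ 2) + f₁ x * -(2 * (x : ℂ)))
    (by rw [hI]; exact fun x hx => (h₂ x hx).mul (hw x))
    (fun x _ => hasDerivWithinAt_eval_ofReal (orthoPoly n) _ x)
    (by rw [← hI] at hcont; exact hcont.intervalIntegrable)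
    ((continuous_eval_ofReal _).intervalIntegrable _ _)
  simp only [orthoPoly_differential_equation, eval_mul, eval_neg, eval_C, eval_orthoPoly] at e1 e2
  simp only [eval_pow, eval_sub, eval_one, eval_X] at e1 e2
  simp at e1 e2
  calc ((n : ℂ) * (n + 1)) * legendreCoeff f n
      = ∫ x in (-1 : ℝ)..1, f x * (n * (n + 1) * (orthoLegendre n x : ℂ)) := by
        rw [legendreCoeff, ← intervalIntegral.integral_const_mul]
        exact intervalIntegral.integral_congr fun x _ => by ring
    _ = _ := e1
    _ = _ := by simp_rw [← mul_assoc]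
    _ = _ := e2
    _ = _ := by
        rw [legendreCoeff]
        exact congrArg _ (intervalIntegral.integral_congr fun x _ => by ring)

theorem norm_mul_legendreCoeff_le (f : ℝ → ℂ) (hf : ContDiffOn ℝ 2 f (Set.Icc (-1) 1)) :
    ∃ C : ℝ, 0 ≤ C ∧ ∀ n : ℕ, ((n : ℝ) * (n + 1)) * ‖legendreCoeff f n‖ ≤ C := by
  have hu : UniqueDiffOn ℝ (Set.Icc (-1 : ℝ) 1) := uniqueDiffOn_Icc (by norm_num)
  have hf₁ : ContDiffOn ℝ 1 (derivWithin f (Set.Icc (-1) 1)) (Set.Icc (-1) 1) :=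
    hf.derivWithin hu (by norm_num)
  have hf₂ : ContDiffOn ℝ 0 (derivWithin (derivWithin f (Set.Icc (-1) 1)) (Set.Icc (-1) 1))
      (Set.Icc (-1) 1) := hf₁.derivWithin hu (by norm_num)
  have hc₁ := hf₁.continuousOn
  have hc₂ := hf₂.continuousOn
  set f₁ := derivWithin f (Set.Icc (-1) 1)
  set f₂ := derivWithin f₁ (Set.Icc (-1) 1)
  have hcont : ContinuousOn (fun x : ℝ => f₂ x * (1 - (x : ℂ) ^ 2) - 2 * x * f₁ x)
      (Set.Icc (-1) 1) := by fun_prop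
  obtain ⟨M, hM⟩ := isCompact_Icc.exists_bound_of_continuousOn hcont
  refine ⟨M * (3 / 2), ?_, fun n => ?_⟩
  · have := (norm_nonneg _).trans (hM 0 (by norm_num))
    positivity
  have h := mul_legendreCoeff_eq f f₁ f₂
    (fun x hx => (hf.differentiableOn (by norm_num) x hx).hasDerivWithinAt)
    (fun x hx => (hf₁.differentiableOn (by norm_num) x hx).hasDerivWithinAt) hc₂ n
  have h' := norm_legendreCoeff_le _ M hM n
  have h3 := congrArg norm h
  rw [norm_neg, norm_mul, norm_mul, ← Nat.cast_succ, Complex.norm_natCast,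
    Complex.norm_natCast] at h3
  rw [← h3] at h'
  simpa using h'

/-! ### Completeness and uniform convergence of the Legendre series. -/

theorem integral_mul_eval_eq_zero (g : ℝ → ℂ) (hg : ContinuousOn g (Set.Icc (-1) 1))
    (h : ∀ n, legendreCoeff g n = 0) (p : ℝ[X]) :
    ∫ x in (-1 : ℝ)..1, g x * ((p.eval x : ℝ) : ℂ) = 0 := by
  have hI : Set.uIcc (-1 : ℝ) 1 = Set.Icc (-1) 1 := Set.uIcc_of_le (by norm_num)
  suffices H : ∀ (n : ℕ) (p : ℝ[X]), p.degree < n →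
      ∫ x in (-1 : ℝ)..1, g x * ((p.eval x : ℝ) : ℂ) = 0 from
    H (p.natDegree + 1) p (degree_le_natDegree.trans_lt (by exact_mod_cast Nat.lt_succ_self _))
  intro n
  induction n with
  | zero =>
    intro p hp
    have : p = 0 := by simpa using hp
    simp [this]
  | succ n ih =>
    intro p hp
    set c : ℝ := p.coeff n / (orthoPoly n).coeff n with hc
    have hq : (p - C c * orthoPoly n).degree < (n : WithBot ℕ) := by
      rw [degree_lt_iff_coeff_zero] at hp ⊢
      intro m hm
      rw [coeff_sub, coeff_C_mul]
      rcases hm.eq_or_lt with rfl | hm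
      · rw [hc, div_mul_cancel₀ _ (coeff_orthoPoly_ne_zero n), sub_self]
      · rw [hp m hm, coeff_eq_zero_of_degree_lt
          ((degree_orthoPoly_le n).trans_lt (by exact_mod_cast hm)), mul_zero, sub_zero]
    have hint (q : ℝ[X]) : IntervalIntegrable (fun x => g x * ((q.eval x : ℝ) : ℂ))
        MeasureTheory.volume (-1) 1 := by
      have := continuous_eval_ofReal q
      refine ContinuousOn.intervalIntegrable ?_
      rw [hI]
      fun_prop
    have h1 := ih _ hq
    have h2 : (fun x => g x * ((p.eval x : ℝ) : ℂ)) = fun x =>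
        g x * (((p - C c * orthoPoly n).eval x : ℝ) : ℂ) +
          (c : ℂ) * (g x * (((orthoPoly n).eval x : ℝ) : ℂ)) := by
      funext x
      simp
      ring
    have h3 := h n
    simp only [legendreCoeff, ← eval_orthoPoly] at h3
    rw [h2, intervalIntegral.integral_add (hint _) ((hint _).const_mul _), h1,
      intervalIntegral.integral_const_mul, h3]
    simp

/-- Completeness of the Legendre polynomials, for continuous functions. -/
theorem eq_zero_of_legendreCoeff_eq_zero (g : ℝ → ℂ) (hg : ContinuousOn g (Set.Icc (-1) 1))
    (h : ∀ n, legendreCoeff g n = 0) {x : ℝ} (hx : x ∈ Set.Icc (-1 : ℝ) 1) : g x = 0 := by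
  have hI : Set.uIcc (-1 : ℝ) 1 = Set.Icc (-1) 1 := Set.uIcc_of_le (by norm_num)
  by_contra hne
  have hpos : 0 < ∫ x in (-1 : ℝ)..1, ‖g x‖ ^ 2 :=
    intervalIntegral.integral_pos (by norm_num) (by fun_prop) (fun _ _ => by positivity)
      ⟨x, hx, by positivity⟩
  obtain ⟨M, hM⟩ := isCompact_Icc.exists_bound_of_continuousOn hg
  have hM0 : 0 ≤ M := (norm_nonneg _).trans (hM x hx)
  set I := ∫ x in (-1 : ℝ)..1, ‖g x‖ ^ 2 with hIdef
  -- With p - iq within 2ε of the conjugate of g, and g orthogonal to polynomials, I ≤ 2·M·2ε =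
  -- I·M/(2(M+1)) < I: the 8 is chosen for this contradiction.
  set ε := I / (8 * (M + 1)) with hε
  have hε0 : 0 < ε := by positivity
  obtain ⟨p, hp⟩ := exists_polynomial_near_of_continuousOn (-1) 1 (fun x => (g x).re)
    (Complex.continuous_re.comp_continuousOn hg) ε hε0
  obtain ⟨q, hq⟩ := exists_polynomial_near_of_continuousOn (-1) 1 (fun x => (g x).im)
    (Complex.continuous_im.comp_continuousOn hg) ε hε0
  have hint (r : ℝ[X]) : IntervalIntegrable (fun x => g x * ((r.eval x : ℝ) : ℂ))
      MeasureTheory.volume (-1) 1 := by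
    have := continuous_eval_ofReal r
    refine ContinuousOn.intervalIntegrable ?_
    rw [hI]
    fun_prop
  have hcs : ContinuousOn (fun x => ((‖g x‖ ^ 2 : ℝ) : ℂ)) (Set.uIcc (-1) 1) := by
    rw [hI]
    exact Complex.continuous_ofReal.comp_continuousOn (hg.norm.pow 2)
  have key : (I : ℂ) = ∫ x in (-1 : ℝ)..1, (((‖g x‖ ^ 2 : ℝ) : ℂ) -
      (g x * ((p.eval x : ℝ) : ℂ) - g x * ((q.eval x : ℝ) : ℂ) * Complex.I)) := by
    rw [intervalIntegral.integral_sub hcs.intervalIntegrable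
      ((hint p).sub ((hint q).mul_const _)),
      intervalIntegral.integral_sub (hint p) ((hint q).mul_const _),
      intervalIntegral.integral_mul_const, integral_mul_eval_eq_zero g hg h p,
      integral_mul_eval_eq_zero g hg h q, intervalIntegral.integral_ofReal]
    simp [hIdef]
  have hbound : ‖(I : ℂ)‖ ≤ M * (2 * ε) * |1 - (-1)| := by
    rw [key]
    refine intervalIntegral.norm_integral_le_of_norm_le_const fun y hy => ?_
    rw [Set.uIoc_of_le (by norm_num)] at hy
    have hy' := Set.Ioc_subset_Icc_self hy
    have e : ((‖g y‖ ^ 2 : ℝ) : ℂ) -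
        (g y * ((p.eval y : ℝ) : ℂ) - g y * ((q.eval y : ℝ) : ℂ) * Complex.I) =
        g y * ((((g y).re - p.eval y : ℝ) : ℂ) + ((q.eval y - (g y).im : ℝ) : ℂ) * Complex.I) := by
      rw [← Complex.normSq_eq_norm_sq, ← Complex.mul_conj]
      apply Complex.ext <;> simp <;> ring
    rw [e, norm_mul]
    refine mul_le_mul (hM y hy') ?_ (norm_nonneg _) hM0
    refine (norm_add_le _ _).trans ?_
    rw [norm_mul, Complex.norm_I, mul_one, Complex.norm_real, Complex.norm_real,
      Real.norm_eq_abs, Real.norm_eq_abs, abs_sub_comm]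
    linarith [hp y hy', hq y hy']
  rw [Complex.norm_real, Real.norm_eq_abs, abs_of_pos hpos] at hbound
  have h2 : M * (2 * ε) * |1 - (-1)| = I * (M / (2 * (M + 1))) := by
    rw [hε]
    norm_num
    field_simp
    norm_num
  have h3 : M / (2 * (M + 1)) < 1 := by
    rw [div_lt_one (by positivity)]
    linarith
  rw [h2] at hbound
  linarith [mul_lt_mul_of_pos_left h3 hpos]

/-- The terms are O(n⁻²)·O(n^{1/2}) = O(n^{-3/2}). They majorize the Legendre series for the
Weierstrass M-test. -/
theorem summable_norm_legendreCoeff_mul_sqrt (f : ℝ → ℂ)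
    (hf : ContDiffOn ℝ 2 f (Set.Icc (-1) 1)) :
    Summable fun n : ℕ => ‖legendreCoeff f n‖ * Real.sqrt ((2 * (n : ℝ) + 1) / 2) := by
  obtain ⟨C, hC0, hC⟩ := norm_mul_legendreCoeff_le f hf
  have hs : Summable fun n : ℕ => C * (1 / (n : ℝ) ^ (3 / 2 : ℝ)) :=
    (Real.summable_one_div_nat_rpow.mpr (by norm_num)).mul_left C
  refine Summable.of_norm_bounded_eventually_nat hs ?_
  filter_upwards [Filter.eventually_ge_atTop 1] with n hn
  have hn0 : (0 : ℝ) < n := by exact_mod_cast hn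
  have e : (n : ℝ) ^ (3 / 2 : ℝ) = n * Real.sqrt n := by
    rw [Real.sqrt_eq_rpow, ← Real.rpow_one_add' hn0.le (by norm_num)]
    norm_num
  have h1 : Real.sqrt ((2 * (n : ℝ) + 1) / 2) * Real.sqrt n ≤ n + 1 := by
    rw [← Real.sqrt_mul (by positivity)]
    exact Real.sqrt_le_iff.mpr ⟨by positivity, by nlinarith⟩
  rw [Real.norm_of_nonneg (by positivity), e, mul_one_div, le_div_iff₀ (by positivity)]
  calc ‖legendreCoeff f n‖ * Real.sqrt ((2 * (n : ℝ) + 1) / 2) * (n * Real.sqrt n)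
      = ‖legendreCoeff f n‖ * n * (Real.sqrt ((2 * (n : ℝ) + 1) / 2) * Real.sqrt n) := by ring
    _ ≤ ‖legendreCoeff f n‖ * n * (n + 1) := by gcongr
    _ ≤ C := by linarith [hC n]

theorem legendreCoeff_orthoLegendre (m n : ℕ) :
    legendreCoeff (fun t => (orthoLegendre m t : ℂ)) n = if m = n then 1 else 0 := by
  have h : legendreCoeff (fun t => (orthoLegendre m t : ℂ)) n =
      (polyIntegral (orthoPoly m * orthoPoly n) : ℂ) := by
    rw [legendreCoeff, polyIntegral_apply, ← intervalIntegral.integral_ofReal]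
    simp [eval_orthoPoly]
  rw [h, polyIntegral_orthoPoly_mul_orthoPoly]
  split_ifs <;> simp

theorem norm_legendre_term_le (f : ℝ → ℂ) (n : ℕ) {x : ℝ} (hx : x ∈ Set.Icc (-1 : ℝ) 1) :
    ‖legendreCoeff f n * (orthoLegendre n x : ℂ)‖ ≤
      ‖legendreCoeff f n‖ * Real.sqrt ((2 * (n : ℝ) + 1) / 2) := by
  rw [norm_mul, Complex.norm_real, Real.norm_eq_abs]
  exact mul_le_mul_of_nonneg_left (abs_orthoLegendre_le n hx) (norm_nonneg _)

/-- The Legendre series of a `C²` function on `[-1, 1]` converges to it. -/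
theorem tsum_legendre_eq (f : ℝ → ℂ) (hf : ContDiffOn ℝ 2 f (Set.Icc (-1) 1)) {x : ℝ}
    (hx : x ∈ Set.Icc (-1 : ℝ) 1) :
    ∑' n, legendreCoeff f n * (orthoLegendre n x : ℂ) = f x := by
  have hI : Set.uIcc (-1 : ℝ) 1 = Set.Icc (-1) 1 := Set.uIcc_of_le (by norm_num)
  have hu := summable_norm_legendreCoeff_mul_sqrt f hf
  set S : ℝ → ℂ := fun x => ∑' n, legendreCoeff f n * (orthoLegendre n x : ℂ) with hS
  have hc (n : ℕ) : Continuous fun x => (orthoLegendre n x : ℂ) :=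
    Complex.continuous_ofReal.comp (continuous_orthoLegendre n)
  have hfc := hf.continuousOn
  have hSc : ContinuousOn S (Set.Icc (-1) 1) :=
    continuousOn_tsum (fun n => (continuous_const.mul (hc n)).continuousOn) hu
      fun n x hx => norm_legendre_term_le f n hx
  -- Termwise integration shows that the sum S has the same coefficients as f; completeness then
  -- forces S = f.
  have hcoeff (m : ℕ) : legendreCoeff S m = legendreCoeff f m := by
    have h1 : HasSum (fun n => ∫ x in (-1 : ℝ)..1,
        legendreCoeff f n * (orthoLegendre n x : ℂ) * (orthoLegendre m x : ℂ))
        (legendreCoeff S m) := by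
      refine intervalIntegral.hasSum_integral_of_dominated_convergence
        (fun n _ => ‖legendreCoeff f n‖ * Real.sqrt ((2 * (n : ℝ) + 1) / 2) *
          Real.sqrt ((2 * (m : ℝ) + 1) / 2))
        (fun n => ((continuous_const.mul (hc n)).mul (hc m)).aestronglyMeasurable)
        (fun n => Filter.Eventually.of_forall fun x hx => ?_)
        (Filter.Eventually.of_forall fun x _ => hu.mul_right _) intervalIntegrable_const
        (Filter.Eventually.of_forall fun x hx => ?_)
      · rw [Set.uIoc_of_le (by norm_num)] at hx
        have hx' := Set.Ioc_subset_Icc_self hx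
        rw [norm_mul, Complex.norm_real (orthoLegendre m x), Real.norm_eq_abs]
        exact mul_le_mul (norm_legendre_term_le f n hx') (abs_orthoLegendre_le m hx')
          (abs_nonneg _) (by positivity)
      · rw [Set.uIoc_of_le (by norm_num)] at hx
        exact (Summable.of_norm_bounded hu fun n =>
          norm_legendre_term_le f n (Set.Ioc_subset_Icc_self hx)).hasSum.mul_right _
    have h2 (n : ℕ) : ∫ x in (-1 : ℝ)..1,
        legendreCoeff f n * (orthoLegendre n x : ℂ) * (orthoLegendre m x : ℂ) =
        if n = m then legendreCoeff f m else 0 := by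
      simp_rw [mul_assoc]
      rw [intervalIntegral.integral_const_mul]
      have h3 := legendreCoeff_orthoLegendre n m
      rw [legendreCoeff] at h3
      rw [h3]
      split_ifs with h
      · rw [h, mul_one]
      · rw [mul_zero]
    simp_rw [h2] at h1
    exact h1.unique (hasSum_ite_eq m _)
  refine sub_eq_zero.mp (eq_zero_of_legendreCoeff_eq_zero (fun x => S x - f x) (hSc.sub hfc)
    (fun m => ?_) hx)
  have hint {g : ℝ → ℂ} (hg : ContinuousOn g (Set.Icc (-1) 1)) :
      IntervalIntegrable (fun x => g x * (orthoLegendre m x : ℂ)) volume (-1) 1 := by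
    rw [← hI] at hg
    exact (hg.mul (hc m).continuousOn).intervalIntegrable
  have h4 := hcoeff m
  simp only [legendreCoeff, sub_mul] at h4 ⊢
  rw [intervalIntegral.integral_sub (hint hSc) (hint hfc), h4, sub_self]

theorem eventually_norm_sub_legendre_sum_le (f : ℝ → ℂ)
    (hf : ContDiffOn ℝ 2 f (Set.Icc (-1) 1)) (ε : ℝ) (hε : 0 < ε) :
    ∃ N₀ : ℕ, ∀ N ≥ N₀, ∀ x ∈ Set.Icc (-1 : ℝ) 1,
      ‖f x - ∑ d ∈ Finset.range (N + 1), legendreCoeff f d * (orthoLegendre d x : ℂ)‖ ≤ ε := by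
  have h := tendstoUniformlyOn_tsum_nat (summable_norm_legendreCoeff_mul_sqrt f hf)
    (s := Set.Icc (-1 : ℝ) 1) (fun n x hx => norm_legendre_term_le f n hx)
  obtain ⟨N₀, hN₀⟩ := Filter.eventually_atTop.mp (Metric.tendstoUniformlyOn_iff.mp h ε hε)
  refine ⟨N₀, fun N hN x hx => ?_⟩
  have := hN₀ (N + 1) (by omega) x hx
  rw [tsum_legendre_eq f hf hx, dist_eq_norm] at this
  exact this.le

theorem heavisideMatrix_sub_truncMatrix (f : ℝ → ℂ) (hf : ContinuousOn f (Set.Icc (-1) 1))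
    (N : ℕ) :
    heavisideMatrix f - truncMatrix f N = heavisideMatrix fun x =>
      f x - ∑ d ∈ Finset.range (N + 1), legendreCoeff f d * (orthoLegendre d x : ℂ) := by
  ext k l
  have hc (n : ℕ) : Continuous fun x => (orthoLegendre n x : ℂ) :=
    Complex.continuous_ofReal.comp (continuous_orthoLegendre n)
  have hp := continuous_eval_ofReal (orthoPrimitive l)
  rw [← Set.uIcc_of_le (by norm_num)] at hf
  simp only [Matrix.sub_apply, truncMatrix, Matrix.sum_apply, Matrix.smul_apply, smul_eq_mul,
    basisMatrix, heavisideMatrix_apply, sub_mul, Finset.sum_mul]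
  rw [intervalIntegral.integral_sub, intervalIntegral.integral_finsetSum]
  · congr 1
    refine Finset.sum_congr rfl fun d _ => ?_
    rw [← intervalIntegral.integral_const_mul]
    exact intervalIntegral.integral_congr fun x _ => by ring
  · intro d _
    exact (((continuous_const.mul (hc d)).mul (hc k)).mul hp).intervalIntegrable _ _
  · exact ((hf.mul (hc k).continuousOn).mul hp.continuousOn).intervalIntegrable
  · exact (continuous_finsetSum _ fun d _ =>
      ((continuous_const.mul (hc d)).mul (hc k)).mul hp).intervalIntegrable _ _

/-! ### Row sums controlled by the sup norm. -/

/-- **Bessel's inequality** for continuous orthonormal functions on an interval. -/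
theorem sum_norm_sq_integral_mul_le (a b : ℝ) (hab : a ≤ b) (e : ℕ → ℝ → ℝ)
    (he : ∀ n, Continuous (e n))
    (hon : ∀ m n, ∫ x in a..b, e m x * e n x = if m = n then 1 else 0)
    (v : ℝ → ℂ) (hv : ContinuousOn v (Set.Icc a b)) (s : Finset ℕ) :
    ∑ n ∈ s, ‖∫ x in a..b, v x * (e n x : ℂ)‖ ^ 2 ≤ ∫ x in a..b, ‖v x‖ ^ 2 := by
  have hmem {g : ℝ → ℂ} (hg : ContinuousOn g (Set.Icc a b)) :
      MemLp g 2 (volume.restrict (Set.Ioc a b)) := by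
    obtain ⟨M, hM⟩ := isCompact_Icc.exists_bound_of_continuousOn hg
    refine MemLp.of_bound ((hg.mono Set.Ioc_subset_Icc_self).aestronglyMeasurable
      measurableSet_Ioc) M ?_
    exact (ae_restrict_iff' measurableSet_Ioc).mpr
      (Filter.Eventually.of_forall fun x hx => hM x (Set.Ioc_subset_Icc_self hx))
  have hinner {g h : ℝ → ℂ} (hg : ContinuousOn g (Set.Icc a b))
      (hh : ContinuousOn h (Set.Icc a b)) :
      inner ℂ ((hmem hg).toLp g) ((hmem hh).toLp h) = ∫ x in a..b, h x * starRingEnd ℂ (g x) := by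
    rw [L2.inner_def, intervalIntegral.integral_of_le hab]
    refine integral_congr_ae ?_
    filter_upwards [(hmem hg).coeFn_toLp, (hmem hh).coeFn_toLp] with x h1 h2
    rw [h1, h2, RCLike.inner_apply]
  have hec (n : ℕ) : ContinuousOn (fun x => (e n x : ℂ)) (Set.Icc a b) :=
    (Complex.continuous_ofReal.comp (he n)).continuousOn
  have horth : Orthonormal ℂ fun n => (hmem (hec n)).toLp fun x => (e n x : ℂ) := by
    rw [orthonormal_iff_ite]
    intro m n
    rw [hinner (hec m) (hec n)]
    simp only [Complex.conj_ofReal, ← Complex.ofReal_mul]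
    rw [intervalIntegral.integral_ofReal, hon]
    by_cases h : m = n
    · simp [h]
    · simp [h, Ne.symm h]
  have hb := horth.sum_inner_products_le ((hmem hv).toLp v) (s := s)
  have hnorm : ‖(hmem hv).toLp v‖ ^ 2 = ∫ x in a..b, ‖v x‖ ^ 2 := by
    have h := inner_self_eq_norm_sq_to_K (𝕜 := ℂ) ((hmem hv).toLp v)
    rw [hinner hv hv] at h
    simp only [Complex.mul_conj, Complex.normSq_eq_norm_sq] at h
    rw [intervalIntegral.integral_ofReal] at h
    norm_cast at h
    exact Complex.ofReal_injective h.symm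
  rw [hnorm] at hb
  simpa only [hinner (hec _) hv, Complex.conj_ofReal] using hb

/-- The normalized derivatives of the Legendre polynomials, with the square root of the weight. -/
noncomputable def weightedDerivative (m : ℕ) (x : ℝ) : ℝ :=
  (Real.sqrt (((m : ℝ) + 1) * (m + 2)))⁻¹ *
    (Real.sqrt (1 - x ^ 2) * (derivative (orthoPoly (m + 1))).eval x)

theorem continuous_weightedDerivative (m : ℕ) : Continuous (weightedDerivative m) := by
  unfold weightedDerivative
  have := (derivative (orthoPoly (m + 1))).continuous
  fun_prop

theorem integral_weightedDerivative_mul (m n : ℕ) :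
    ∫ x in (-1 : ℝ)..1, weightedDerivative m x * weightedDerivative n x =
      if m = n then 1 else 0 := by
  have h : ∫ x in (-1 : ℝ)..1, weightedDerivative m x * weightedDerivative n x =
      ((Real.sqrt (((m : ℝ) + 1) * (m + 2)))⁻¹ * (Real.sqrt (((n : ℝ) + 1) * (n + 2)))⁻¹) *
        polyIntegral ((1 - X ^ 2) * derivative (orthoPoly (m + 1)) *
          derivative (orthoPoly (n + 1))) := by
    rw [polyIntegral_apply, ← intervalIntegral.integral_const_mul]
    refine intervalIntegral.integral_congr fun x hx => ?_
    rw [Set.uIcc_of_le (by norm_num)] at hx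
    have hs : Real.sqrt (1 - x ^ 2) * Real.sqrt (1 - x ^ 2) = 1 - x ^ 2 :=
      Real.mul_self_sqrt (by nlinarith [hx.1, hx.2])
    simp only [weightedDerivative, eval_mul, eval_sub, eval_one, eval_pow, eval_X]
    generalize Real.sqrt (1 - x ^ 2) = y at hs ⊢
    rw [← hs]
    ring
  rw [h, polyIntegral_weight_mul_derivative_mul_derivative]
  rcases eq_or_ne m n with rfl | hmn
  · have h0 : (0 : ℝ) < ((m : ℝ) + 1) * (m + 2) := by positivity
    rw [if_pos rfl, if_pos rfl, ← mul_inv, Real.mul_self_sqrt h0.le]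
    push_cast
    field_simp
    ring
  · simp [hmn]

/-- The primitive of p_0 is at most 2 in absolute value, and ∫|p_k| ≤ 3/2, whence the 3. -/
theorem norm_heavisideMatrix_zero_le (r : ℝ → ℂ) (ε : ℝ)
    (hε : ∀ x ∈ Set.Icc (-1 : ℝ) 1, ‖r x‖ ≤ ε) (k : ℕ) : ‖heavisideMatrix r k 0‖ ≤ 3 * ε := by
  have h0 : 0 ≤ ε := (norm_nonneg _).trans (hε 0 (by norm_num))
  have h : heavisideMatrix r k 0 =
      legendreCoeff (fun x => r x * (((orthoPrimitive 0).eval x : ℝ) : ℂ)) k := by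
    rw [heavisideMatrix_apply, legendreCoeff]
    exact intervalIntegral.integral_congr fun x _ => by ring
  have hs : Real.sqrt (1 / 2) ≤ 1 := Real.sqrt_le_one.mpr (by norm_num)
  rw [h]
  refine (norm_legendreCoeff_le _ (ε * 2) (fun x hx => ?_) k).trans_eq (by ring)
  rw [norm_mul, Complex.norm_real, orthoPrimitive, if_pos rfl, eval_mul, eval_C, norm_mul,
    Real.norm_of_nonneg (Real.sqrt_nonneg _)]
  refine mul_le_mul (hε x hx) ?_ (by positivity) h0
  have : ‖(X + 1 : ℝ[X]).eval x‖ ≤ 2 := by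
    simp only [eval_add, eval_X, eval_one]
    rw [Real.norm_eq_abs, abs_le]
    constructor <;> linarith [hx.1, hx.2]
  nlinarith [norm_nonneg ((X + 1 : ℝ[X]).eval x), Real.sqrt_nonneg (1 / 2)]

/-- The weight 1-x² is split into two square roots: one makes the derivatives orthonormal, the other
stays with r p_k. The index is shifted because p_0' = 0. -/
theorem heavisideMatrix_succ (r : ℝ → ℂ) (k m : ℕ) :
    heavisideMatrix r k (m + 1) =
      ((-(Real.sqrt (((m : ℝ) + 1) * (m + 2)))⁻¹ : ℝ) : ℂ) * ∫ x in (-1 : ℝ)..1,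
        (r x * (orthoLegendre k x : ℂ) * (Real.sqrt (1 - x ^ 2) : ℂ)) *
          (weightedDerivative m x : ℂ) := by
  rw [heavisideMatrix_apply, ← intervalIntegral.integral_const_mul]
  refine intervalIntegral.integral_congr fun x hx => ?_
  rw [Set.uIcc_of_le (by norm_num)] at hx
  have hs : Real.sqrt (1 - x ^ 2) * Real.sqrt (1 - x ^ 2) = 1 - x ^ 2 :=
    Real.mul_self_sqrt (by nlinarith [hx.1, hx.2])
  have h0 : (0 : ℝ) < ((m : ℝ) + 1) * (m + 2) := by positivity
  have hl : Real.sqrt (((m : ℝ) + 1) * (m + 2)) * Real.sqrt (((m : ℝ) + 1) * (m + 2)) =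
    ((m : ℝ) + 1) * (m + 2) := Real.mul_self_sqrt h0.le
  have e : (orthoPrimitive (m + 1)).eval x = -(Real.sqrt (((m : ℝ) + 1) * (m + 2)))⁻¹ *
      (Real.sqrt (1 - x ^ 2) * weightedDerivative m x) := by
    have h1 : ((m + 1 : ℕ) : ℝ) * (((m + 1 : ℕ) : ℝ) + 1) = ((m : ℝ) + 1) * (m + 2) := by
      push_cast
      ring
    rw [orthoPrimitive, if_neg m.succ_ne_zero, h1]
    simp only [weightedDerivative, eval_mul, eval_sub, eval_one, eval_pow, eval_X, eval_C]
    generalize Real.sqrt (1 - x ^ 2) = y at hs ⊢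
    generalize Real.sqrt (((m : ℝ) + 1) * (m + 2)) = z at hl ⊢
    rw [← hs, ← hl, mul_inv]
    ring
  simp only [e]
  push_cast
  ring

theorem sum_range_inv_mul_le_one (n : ℕ) :
    ∑ m ∈ Finset.range n, (((m : ℝ) + 1) * (m + 2))⁻¹ ≤ 1 := by
  have h : ∑ m ∈ Finset.range n, (((m : ℝ) + 1) * (m + 2))⁻¹ = 1 - ((n : ℝ) + 1)⁻¹ := by
    induction n with
    | zero => simp
    | succ n ih =>
      rw [Finset.sum_range_succ, ih]
      push_cast
      field_simp
      ring
  rw [h]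
  have : (0 : ℝ) ≤ ((n : ℝ) + 1)⁻¹ := by positivity
  linarith

/-- Cauchy–Schwarz: Bessel bounds one factor by ∫|r p_k|²(1-x²) ≤ ε², where ∫p_k² = 1 makes the
bound independent of k; the other factor telescopes to at most 1. -/
theorem sum_norm_heavisideMatrix_succ_le (r : ℝ → ℂ) (hr : ContinuousOn r (Set.Icc (-1) 1)) (ε : ℝ)
    (hε : ∀ x ∈ Set.Icc (-1 : ℝ) 1, ‖r x‖ ≤ ε) (k n : ℕ) :
    ∑ m ∈ Finset.range n, ‖heavisideMatrix r k (m + 1)‖ ≤ ε := by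
  have h0 : 0 ≤ ε := (norm_nonneg _).trans (hε 0 (by norm_num))
  have hk := continuous_orthoLegendre k
  have hck : Continuous fun x => (orthoLegendre k x : ℂ) := Complex.continuous_ofReal.comp hk
  have hcw : Continuous fun x : ℝ => (Real.sqrt (1 - x ^ 2) : ℂ) :=
    Complex.continuous_ofReal.comp (by fun_prop)
  set v : ℝ → ℂ := fun x => r x * (orthoLegendre k x : ℂ) * (Real.sqrt (1 - x ^ 2) : ℂ) with hv
  have hvc : ContinuousOn v (Set.Icc (-1) 1) := (hr.mul hck.continuousOn).mul hcw.continuousOn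
  have hbessel := sum_norm_sq_integral_mul_le (-1) 1 (by norm_num) weightedDerivative
    continuous_weightedDerivative integral_weightedDerivative_mul v hvc (Finset.range n)
  have hnorm : ∫ x in (-1 : ℝ)..1, ‖v x‖ ^ 2 ≤ ε ^ 2 := by
    have h1 : ∫ x in (-1 : ℝ)..1, ‖v x‖ ^ 2 ≤
        ∫ x in (-1 : ℝ)..1, ε ^ 2 * orthoLegendre k x ^ 2 := by
      refine intervalIntegral.integral_mono_on (by norm_num) ?_
        (Continuous.intervalIntegrable (by fun_prop) _ _) fun x hx => ?_
      · rw [← Set.uIcc_of_le (by norm_num)] at hvc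
        exact (hvc.norm.pow 2).intervalIntegrable
      · have hw : Real.sqrt (1 - x ^ 2) ≤ 1 := Real.sqrt_le_one.mpr (by nlinarith)
        rw [hv, norm_mul, norm_mul, Complex.norm_real, Complex.norm_real,
          Real.norm_of_nonneg (Real.sqrt_nonneg _), ← sq_abs (orthoLegendre k x), ← mul_pow]
        refine pow_le_pow_left₀ (by positivity) ?_ 2
        calc ‖r x‖ * |orthoLegendre k x| * Real.sqrt (1 - x ^ 2)
            ≤ ε * |orthoLegendre k x| * 1 := by
              gcongr
              exact hε x hx
          _ = _ := mul_one _
    rwa [intervalIntegral.integral_const_mul, integral_orthoLegendre_sq, mul_one] at h1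
  have hterm (m : ℕ) : ‖heavisideMatrix r k (m + 1)‖ =
      ‖∫ x in (-1 : ℝ)..1, v x * (weightedDerivative m x : ℂ)‖ *
        (Real.sqrt (((m : ℝ) + 1) * (m + 2)))⁻¹ := by
    rw [heavisideMatrix_succ, norm_mul, Complex.norm_real, norm_neg,
      Real.norm_of_nonneg (by positivity), mul_comm]
  simp only [hterm]
  refine abs_le_of_sq_le_sq' ?_ h0 |>.2
  refine (Finset.sum_mul_sq_le_sq_mul_sq _ _ _).trans ?_
  have hsq : ∑ m ∈ Finset.range n, (Real.sqrt (((m : ℝ) + 1) * (m + 2)))⁻¹ ^ 2 ≤ 1 := by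
    refine le_of_eq_of_le (Finset.sum_congr rfl fun m _ => ?_) (sum_range_inv_mul_le_one n)
    rw [inv_pow, Real.sq_sqrt (by positivity)]
  calc _ ≤ ε ^ 2 * 1 := mul_le_mul (hbessel.trans hnorm) hsq (by positivity) (by positivity)
    _ = ε ^ 2 := mul_one _

/-- The infinity norm of the coefficient matrix is controlled by the sup norm of the function. -/
theorem infNorm_heavisideMatrix_le (r : ℝ → ℂ) (hr : ContinuousOn r (Set.Icc (-1) 1)) (ε : ℝ)
    (hε : ∀ x ∈ Set.Icc (-1 : ℝ) 1, ‖r x‖ ≤ ε) :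
    infNorm (heavisideMatrix r) ≤ ENNReal.ofReal (4 * ε) := by
  refine iSup_le fun k => ENNReal.tsum_le_of_sum_range_le fun n => ?_
  have h : ∑ l ∈ Finset.range n, ‖heavisideMatrix r k l‖ ≤ 4 * ε := by
    calc ∑ l ∈ Finset.range n, ‖heavisideMatrix r k l‖
        ≤ ∑ l ∈ Finset.range (n + 1), ‖heavisideMatrix r k l‖ :=
          Finset.sum_le_sum_of_subset_of_nonneg (Finset.range_mono n.le_succ)
            fun _ _ _ => norm_nonneg _
      _ = ∑ l ∈ Finset.range n, ‖heavisideMatrix r k (l + 1)‖ + ‖heavisideMatrix r k 0‖ :=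
          Finset.sum_range_succ' _ n
      _ ≤ 4 * ε := by
          linarith [sum_norm_heavisideMatrix_succ_le r hr ε hε k n,
            norm_heavisideMatrix_zero_le r ε hε k]
  simp only [← ofReal_norm]
  rw [← ENNReal.ofReal_sum_of_nonneg fun _ _ => norm_nonneg _]
  exact ENNReal.ofReal_le_ofReal h

end LegendreBand

theorem mainTheorem2 (f : ℝ → ℂ) (hf : AnalyticOn ℝ f (Set.Icc (-1 : ℝ) 1)) :
    (∀ δ : ℝ, 0 < δ → ∃ N₀ : ℕ, ∀ N : ℕ, N₀ ≤ N →
      LegendreBand.IsBanded (N + 1) (LegendreBand.truncMatrix f N) ∧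
      LegendreBand.infNorm (LegendreBand.heavisideMatrix f - LegendreBand.truncMatrix f N)
        ≤ ENNReal.ofReal δ) ∧
    LegendreBand.IsNumericallyBanded (LegendreBand.heavisideMatrix f) := by
  have hf2 : ContDiffOn ℝ 2 f (Set.Icc (-1) 1) := hf.contDiffOn (uniqueDiffOn_Icc (by norm_num))
  have hfc := hf2.continuousOn
  have main : ∀ δ : ℝ, 0 < δ → ∃ N₀ : ℕ, ∀ N : ℕ, N₀ ≤ N →
      LegendreBand.IsBanded (N + 1) (LegendreBand.truncMatrix f N) ∧
      LegendreBand.infNorm (LegendreBand.heavisideMatrix f - LegendreBand.truncMatrix f N)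
        ≤ ENNReal.ofReal δ := by
    intro δ hδ
    -- The 4 is the operator bound: 3 from column 0 and 1 from the remaining columns.
    obtain ⟨N₀, hN₀⟩ := LegendreBand.eventually_norm_sub_legendre_sum_le f hf2 (δ / 4)
      (by positivity)
    refine ⟨N₀, fun N hN => ⟨LegendreBand.isBanded_truncMatrix f N, ?_⟩⟩
    rw [LegendreBand.heavisideMatrix_sub_truncMatrix f hfc N]
    refine (LegendreBand.infNorm_heavisideMatrix_le _ (hfc.sub (Continuous.continuousOn ?_)) _
      (hN₀ N hN)).trans_eq (by rw [mul_div_cancel₀ δ four_ne_zero])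
    exact continuous_finsetSum _ fun d _ => continuous_const.mul
      (Complex.continuous_ofReal.comp (LegendreBand.continuous_orthoLegendre d))
  refine ⟨main, fun δ hδ => ?_⟩
  obtain ⟨N₀, hN₀⟩ := main δ hδ
  exact ⟨N₀ + 1, _, (hN₀ N₀ le_rfl).1, (hN₀ N₀ le_rfl).2⟩
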